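/- Conventions. For a metric space $(X,d)$ let $\mathsf{La}(X)$ be the set of pairs $(A,x)$ with $A\subseteq X$ finite and $x\in X$. Put $$\mathsf{TSP}((A,x),(B,y))=\inf\Big\{\sum_{i=1}^k d(x_{i-1},x_i):\ k\ge 0,\ x_0=x,\ x_k=y,\ A\Delta B\subseteq\{x_0,\dots,x_k\}\Big\},$$ $$\mathsf{TSCP}((A,x),(B,y))=\operatorname{diam}(\{x,y\}\cup(A\Delta B)),$$ let $\rho((A,x),(B,y))=0$ if $A=B$ and $1$ otherwise, and equip $\mathsf{La}(X)$ with the metric $d_{\mathsf{La}}=\mathsf{TSP}+\rho$. For $K\in\mathbb R$, the space $X$ is called $K$-TSP-efficient if $\mathsf{TSP}\le K\cdot\mathsf{TSCP}$ on $\mathsf{La}(X)\times\mathsf{La}(X)$. An $\mathbb R$-tree is a metric space in which any two distinct points are joined by a unique arc, and this arc is a geodesic. A weak $C$-biLipschitz embedding of a metric space $(Y,\rho_Y)$ into a metric space $(Z,\rho_Z)$ is a family of maps $\varphi^t:Y\to Z$, $t>0$, such that for every $t>0$ there is $\sigma_t\in(0,\infty)$ with, for all $x,y\in Y$, - $\rho_Z(\varphi^t(x),\varphi^t(y))\le\sigma_t\,\rho_Y(x,y)$,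 and - $\rho_Z(\varphi^t(x),\varphi^t(y))\ge t\sigma_t$ whenever $\rho_Y(x,y)\ge Ct$. **Theorem.** For every $K\in\mathbb R$ there exist $n\in\mathbb N$ and $C<\infty$, depending only on $K$, such that for every finite $K$-TSP-efficient metric space $X$ there exist $\mathbb R$-trees $T_1,\dots,T_n$ such that $(\mathsf{La}(X),d_{\mathsf{La}})$ admits a weak $C$-biLipschitz embedding into $T_1\times\cdots\times T_n$ equipped with the $\ell_\infty$-product (maximum) metric. -/

import Mathlib

/-! ### Real trees -/

/-- `A` is an arc joining `x` to `y`: the image of an injective continuous path from `x` to `y`.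
(On the compact interval such a path is a homeomorphism onto its image.) -/
def IsArcJoining {T : Type*} [TopologicalSpace T] (x y : T) (A : Set T) : Prop :=
  ∃ p : Path x y, Function.Injective p ∧ Set.range p = A

/-- `A` is a geodesic segment from `x` to `y`: the image of an isometric embedding of
`[0, dist x y]` that starts at `x` and ends at `y`. -/
def IsGeodesicSegment {T : Type*} [MetricSpace T] (x y : T) (A : Set T) : Prop :=
  ∃ γ : ℝ → T, γ 0 = x ∧ γ (dist x y) = y ∧
    (∀ s ∈ Set.Icc 0 (dist x y), ∀ t ∈ Set.Icc 0 (dist x y), dist (γ s) (γ t) = |s - t|) ∧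
    γ '' Set.Icc 0 (dist x y) = A

/-- An `ℝ`-tree: any two distinct points are joined by a unique arc, and this arc is a
geodesic. -/
def IsRTree (T : Type*) [MetricSpace T] : Prop :=
  ∀ x y : T, x ≠ y →
    ∃ A : Set T, IsArcJoining x y A ∧ (∀ B : Set T, IsArcJoining x y B → B = A) ∧
      IsGeodesicSegment x y A

/-! ### Weak biLipschitz embeddings -/

/-- The family `φ t`, `t > 0`, is a weak `C`-biLipschitz embedding of `Y` into `Z`
(the values of `φ` at `t ≤ 0` play no role). -/
def IsWeakBiLipschitzEmbedding {Y Z : Type*} [MetricSpace Y] [MetricSpace Z]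
    (C : ℝ) (φ : ℝ → Y → Z) : Prop :=
  ∀ t : ℝ, 0 < t → ∃ σ : ℝ, 0 < σ ∧ ∀ x y : Y,
    dist (φ t x) (φ t y) ≤ σ * dist x y ∧
    (C * t ≤ dist x y → t * σ ≤ dist (φ t x) (φ t y))

/-! ### Lamplighter spaces -/

/-- Points of the lamplighter space over `X`: a finite set of lit lamps and a position. -/
@[ext] structure Lamplighter (X : Type*) where
  lamps : Finset X
  pos : X

namespace Lamplighter

variable {X : Type*}

/-- The set of points at which two lamp configurations differ. -/
def diffLamps (a b : Lamplighter X) : Set X :=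
  symmDiff (a.lamps : Set X) (b.lamps : Set X)

/-- The lengths of the finite walks `p 0, …, p k` that start at the position of `a`, end at the
position of `b` and visit all points at which the lamps of `a` and `b` differ. -/
def walkLengths [MetricSpace X] (a b : Lamplighter X) : Set ℝ :=
  {L | ∃ (k : ℕ) (p : ℕ → X), p 0 = a.pos ∧ p k = b.pos ∧
    (∀ z ∈ diffLamps a b, ∃ i ≤ k, p i = z) ∧
    L = ∑ i ∈ Finset.range k, dist (p i) (p (i + 1))}

/-- The length of the solution of the traveling salesman problem. -/
noncomputable def tsp [MetricSpace X] (a b : Lamplighter X) : ℝ :=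
  sInf (walkLengths a b)

/-- The length of the solution of the traveling salesman shortcut problem. -/
noncomputable def tscp [MetricSpace X] (a b : Lamplighter X) : ℝ :=
  Metric.diam ({a.pos, b.pos} ∪ diffLamps a b)

open Classical in
/-- The discrete semimetric on lamp configurations. -/
noncomputable def rho (a b : Lamplighter X) : ℝ :=
  if a.lamps = b.lamps then 0 else 1

theorem diffLamps_comm (a b : Lamplighter X) : diffLamps a b = diffLamps b a :=
  symmDiff_comm _ _

theorem diffLamps_subset (a b c : Lamplighter X) :
    diffLamps a c ⊆ diffLamps a b ∪ diffLamps b c := by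
  intro z hz
  simp only [diffLamps, Set.mem_symmDiff, Set.mem_union] at hz ⊢
  tauto

theorem diffLamps_finite (a b : Lamplighter X) : (diffLamps a b).Finite :=
  (a.lamps.finite_toSet.union b.lamps.finite_toSet).subset symmDiff_le_sup

theorem rho_comm (a b : Lamplighter X) : rho a b = rho b a := by
  unfold rho
  by_cases h : a.lamps = b.lamps <;> simp [h, Ne.symm]

theorem rho_triangle (a b c : Lamplighter X) : rho a c ≤ rho a b + rho b c := by
  unfold rho
  by_cases h₁ : a.lamps = b.lamps <;> by_cases h₂ : b.lamps = c.lamps <;>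
    by_cases h₃ : a.lamps = c.lamps <;> simp_all

variable [MetricSpace X]

theorem dist_le_of_mem_walkLengths {a b : Lamplighter X} {L : ℝ} (h : L ∈ walkLengths a b) :
    dist a.pos b.pos ≤ L := by
  obtain ⟨k, p, h0, hk, -, rfl⟩ := h
  rw [← h0, ← hk]
  exact dist_le_range_sum_dist p k

theorem walkLengths_bddBelow (a b : Lamplighter X) : BddBelow (walkLengths a b) :=
  ⟨_, fun _ h => dist_le_of_mem_walkLengths h⟩

theorem walkLengths_nonempty (a b : Lamplighter X) : (walkLengths a b).Nonempty := by
  set l : List X := (diffLamps_finite a b).toFinset.toList with hl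
  refine ⟨_, l.length + 1,
    fun i => if i = 0 then a.pos else l.getD (i - 1) b.pos, by simp, by simp, ?_, rfl⟩
  intro z hz
  have hz' : z ∈ l := by simpa [hl] using hz
  obtain ⟨i, hi, rfl⟩ := List.getElem_of_mem hz'
  exact ⟨i + 1, by omega, by simp [hi]⟩

theorem walkLengths_symm {a b : Lamplighter X} {L : ℝ} (h : L ∈ walkLengths a b) :
    L ∈ walkLengths b a := by
  obtain ⟨k, p, h0, hk, hv, rfl⟩ := h
  refine ⟨k, fun i => p (k - i), by simpa using hk, by simpa using h0, ?_, ?_⟩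
  · intro z hz
    rw [diffLamps_comm] at hz
    obtain ⟨i, hi, rfl⟩ := hv z hz
    exact ⟨k - i, by omega, by simp [Nat.sub_sub_self hi]⟩
  · rw [← Finset.sum_range_reflect]
    refine Finset.sum_congr rfl fun i hi => ?_
    have hi' : i < k := Finset.mem_range.1 hi
    rw [dist_comm]
    have e1 : k - 1 - i + 1 = k - i := by omega
    have e2 : k - 1 - i = k - (i + 1) := by omega
    rw [e1, e2]

theorem walkLengths_add {a b c : Lamplighter X} {L M : ℝ} (hL : L ∈ walkLengths a b)
    (hM : M ∈ walkLengths b c) : L + M ∈ walkLengths a c := by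
  obtain ⟨k, p, p0, pk, pv, rfl⟩ := hL
  obtain ⟨m, q, q0, qm, qv, rfl⟩ := hM
  have hlow : ∀ i ≤ k, (if i ≤ k then p i else q (i - k)) = p i := fun i hi => if_pos hi
  have hhigh : ∀ j, (if k + j ≤ k then p (k + j) else q (k + j - k)) = q j := by
    intro j
    rcases Nat.eq_zero_or_pos j with rfl | hj
    · simp [pk, q0]
    · rw [if_neg (by omega), Nat.add_sub_cancel_left]
  refine ⟨k + m, fun i => if i ≤ k then p i else q (i - k), by simpa using p0,
    (hhigh m).trans qm, ?_, ?_⟩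
  · intro z hz
    rcases diffLamps_subset a b c hz with h | h
    · obtain ⟨i, hi, rfl⟩ := pv z h
      exact ⟨i, by omega, hlow i hi⟩
    · obtain ⟨j, hj, rfl⟩ := qv z h
      exact ⟨k + j, by omega, hhigh j⟩
  · rw [Finset.sum_range_add]
    congr 1
    · refine Finset.sum_congr rfl fun i hi => ?_
      have hi' : i < k := Finset.mem_range.1 hi
      simp only [hlow i hi'.le, hlow (i + 1) hi']
    · refine Finset.sum_congr rfl fun j _ => ?_
      have h1 := hhigh (j + 1)
      rw [← add_assoc] at h1
      simp only [hhigh j, h1]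

theorem dist_le_tsp (a b : Lamplighter X) : dist a.pos b.pos ≤ tsp a b :=
  le_csInf (walkLengths_nonempty a b) fun _ h => dist_le_of_mem_walkLengths h

theorem tsp_self (a : Lamplighter X) : tsp a a = 0 := by
  refine le_antisymm (csInf_le (walkLengths_bddBelow a a) ?_) (dist_nonneg.trans (dist_le_tsp a a))
  exact ⟨0, fun _ => a.pos, rfl, rfl, by simp [diffLamps], by simp⟩

theorem tsp_comm (a b : Lamplighter X) : tsp a b = tsp b a :=
  congrArg sInf (Set.Subset.antisymm (fun _ => walkLengths_symm) (fun _ => walkLengths_symm))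

theorem tsp_triangle (a b c : Lamplighter X) : tsp a c ≤ tsp a b + tsp b c := by
  have key : ∀ L ∈ walkLengths a b, ∀ M ∈ walkLengths b c, tsp a c ≤ L + M := fun L hL M hM =>
    csInf_le (walkLengths_bddBelow a c) (walkLengths_add hL hM)
  have h1 : ∀ L ∈ walkLengths a b, tsp a c - L ≤ tsp b c := fun L hL =>
    le_csInf (walkLengths_nonempty b c) fun M hM => by linarith [key L hL M hM]
  have h2 : tsp a c - tsp b c ≤ tsp a b :=
    le_csInf (walkLengths_nonempty a b) fun L hL => by linarith [h1 L hL]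
  linarith

/-- The lamplighter space with the traveling salesman metric `tsp + rho`. -/
noncomputable instance : MetricSpace (Lamplighter X) where
  dist a b := tsp a b + rho a b
  dist_self a := by simp [tsp_self, rho]
  dist_comm a b := by rw [tsp_comm a b, rho_comm a b]
  dist_triangle a b c := by linarith [tsp_triangle a b c, rho_triangle a b c]
  eq_of_dist_eq_zero := by
    intro a b h
    have h1 : dist a.pos b.pos ≤ tsp a b := dist_le_tsp a b
    have h2 : (0 : ℝ) ≤ dist a.pos b.pos := dist_nonneg
    unfold rho at h
    split_ifs at h with hl
    · exact Lamplighter.ext hl (dist_le_zero.1 (by linarith))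
    · linarith

theorem dist_def (a b : Lamplighter X) : dist a b = tsp a b + rho a b := rfl

end Lamplighter

/-- `X` is `K`-TSP-efficient: the traveling salesman length is at most `K` times the length of
the shortcut problem. -/
def IsTSPEfficient (K : ℝ) (X : Type*) [MetricSpace X] : Prop :=
  ∀ a b : Lamplighter X, Lamplighter.tsp a b ≤ K * Lamplighter.tscp a b

/-! At each scale `t` a product of hedgehogs suffices, one factor per colour of a `t`-dense net.
TSP-efficiency applied to switching off a separated set shows that such sets grow at most linearly
(`IsTSPEfficient.card_sub_one_mul_le`). Hence a `t`-separated net can be coloured with a number of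
colours depending only on `K`, so that centres of one colour are `4 t` apart and their balls of
radius `r = 2 t` are disjoint.

For one colour, a state whose position lies in the ball around a centre `z` is sent to height `r -
dist pos z` on a leg coding `z` together with the lamps at distance at least `2 r` from `z`. A
change of leg costs at least the descent to the origin and the climb back: either the walker crosses
to another ball, or it travels to a far lamp. This makes the map 1-Lipschitz (`dist_toHedgehog_le`).

Conversely, two states with the same code differ only inside a ball of radius `2 r`, so efficiency
bounds their distance by a multiple of `r`. States further apart therefore never share a leg code,
and they are separated by at least the height of the first one (`sub_dist_le_dist_toHedgehog`).
Since some net point is within `t` of the position, that height exceeds `t` in some factor. The term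
`rho` matters only at small scales, where the whole lamp configuration is coded. -/

/-! ### Hedgehogs are real trees -/

/-- A metric space is a real tree as soon as any two points are joined by a geodesic that is
covered by every path with the same end points. -/
theorem isRTree_of_geodesic {T : Type*} [MetricSpace T]
    (h : ∀ x y : T, x ≠ y → ∃ γ : ℝ → T, γ 0 = x ∧ γ (dist x y) = y ∧
      (∀ s ∈ Set.Icc 0 (dist x y), ∀ t ∈ Set.Icc 0 (dist x y), dist (γ s) (γ t) = |s - t|) ∧
      ∀ p : Path x y, ∀ s ∈ Set.Icc 0 (dist x y), γ s ∈ Set.range p) : IsRTree T := by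
  intro x y hxy
  obtain ⟨γ, h0, h1, hiso, hsep⟩ := h x y hxy
  have hd : 0 < dist x y := dist_pos.2 hxy
  have hmem : ∀ s : unitInterval, (s : ℝ) * dist x y ∈ Set.Icc 0 (dist x y) := fun s =>
    ⟨mul_nonneg s.2.1 hd.le, mul_le_of_le_one_left hd.le s.2.2⟩
  have hdist : ∀ s t : unitInterval,
      dist (γ (s * dist x y)) (γ (t * dist x y)) = dist x y * dist s t := by
    intro s t
    rw [hiso _ (hmem s) _ (hmem t), ← sub_mul, abs_mul, abs_of_pos hd, mul_comm]
    rfl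
  have hcont : Continuous fun s : unitInterval => γ (s * dist x y) :=
    (LipschitzWith.of_dist_le_mul (K := ⟨dist x y, hd.le⟩) fun s t => (hdist s t).le).continuous
  have himage : Set.range (fun s : unitInterval => γ (s * dist x y)) =
      γ '' Set.Icc 0 (dist x y) := by
    ext z
    constructor
    · rintro ⟨s, rfl⟩
      exact ⟨_, hmem s, rfl⟩
    · rintro ⟨s, hs, rfl⟩
      refine ⟨⟨s / dist x y, div_nonneg hs.1 hd.le, (div_le_one hd).2 hs.2⟩, ?_⟩
      simp [div_mul_cancel₀ _ hd.ne']
  refine ⟨γ '' Set.Icc 0 (dist x y), ?_, ?_, γ, h0, h1, hiso, rfl⟩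
  · refine ⟨⟨⟨_, hcont⟩, by simpa using h0, by simpa using h1⟩, ?_, himage⟩
    intro s t hst
    have h2 := hdist s t
    have h3 : γ (s * dist x y) = γ (t * dist x y) := hst
    rw [h3, dist_self] at h2
    exact dist_eq_zero.1 ((mul_eq_zero.1 h2.symm).resolve_left hd.ne')
  · rintro B ⟨p, hp, rfl⟩
    refine Set.Subset.antisymm ?_ fun z => ?_
    · rintro _ ⟨u, rfl⟩
      -- An arc is a homeomorphism onto its image, so the geodesic can be pulled back along `p` to a
      -- continuous self-map `q` of the unit interval fixing both ends. By the intermediate value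
      -- theorem `q` is onto, so the arc has no points off the geodesic.
      let e := (p.continuous.isClosedEmbedding hp).isEmbedding.toHomeomorph
      let q : unitInterval → unitInterval := fun s =>
        e.symm ⟨γ (s * dist x y), hsep p _ (hmem s)⟩
      have hq : Continuous q := e.symm.continuous.comp (hcont.subtype_mk _)
      have hpq : ∀ s, p (q s) = γ (s * dist x y) := fun s =>
        congrArg Subtype.val (e.apply_symm_apply ⟨γ (s * dist x y), hsep p _ (hmem s)⟩)
      have hq0 : q 0 = 0 := hp (by rw [hpq]; simp [h0])
      have hq1 : q 1 = 1 := hp (by rw [hpq]; simp [h1])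
      obtain ⟨s, hs⟩ := mem_range_of_exists_le_of_exists_ge hq
        ⟨0, hq0.le.trans u.2.1⟩ ⟨1, (show u ≤ 1 from u.2.2).trans hq1.ge⟩
      exact ⟨_, hmem s, by rw [← hs, hpq]⟩
    · rintro ⟨s, hs, rfl⟩
      exact hsep p s hs

/-- The hedgehog with countably many legs: half-lines `[0, ∞)` glued at the origin, which is
represented on the leg `0`. -/
@[ext] structure Hedgehog where
  leg : ℕ
  height : ℝ
  height_nonneg : 0 ≤ height
  leg_eq_zero : height = 0 → leg = 0

namespace Hedgehog

noncomputable instance : Dist Hedgehog where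
  dist x y := if x.leg = y.leg then |x.height - y.height| else x.height + y.height

theorem dist_eq_abs {x y : Hedgehog} (h : x.leg = y.leg) : dist x y = |x.height - y.height| :=
  if_pos h

theorem dist_eq_add {x y : Hedgehog} (h : x.leg ≠ y.leg) : dist x y = x.height + y.height :=
  if_neg h

theorem abs_sub_le_dist (x y : Hedgehog) : |x.height - y.height| ≤ dist x y := by
  by_cases h : x.leg = y.leg
  · rw [dist_eq_abs h]
  · rw [dist_eq_add h, abs_le]
    constructor <;> linarith [x.height_nonneg, y.height_nonneg]

theorem dist_le_add (x y : Hedgehog) : dist x y ≤ x.height + y.height := by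
  by_cases h : x.leg = y.leg
  · rw [dist_eq_abs h, abs_le]
    constructor <;> linarith [x.height_nonneg, y.height_nonneg]
  · rw [dist_eq_add h]

noncomputable instance : MetricSpace Hedgehog where
  dist_self x := by simp [dist_eq_abs]
  dist_comm x y := by
    by_cases h : x.leg = y.leg
    · rw [dist_eq_abs h, dist_eq_abs h.symm, abs_sub_comm]
    · rw [dist_eq_add h, dist_eq_add (Ne.symm h), add_comm]
  dist_triangle x y z := by
    have h1 := abs_le.1 (abs_sub_le_dist x y)
    have h2 := abs_le.1 (abs_sub_le_dist y z)
    by_cases h : x.leg = z.leg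
    · rw [dist_eq_abs h, abs_le]
      constructor <;> linarith
    · rw [dist_eq_add h]
      by_cases hy : x.leg = y.leg
      · rw [dist_eq_add fun h' => h (hy.trans h')]
        linarith
      · rw [dist_eq_add hy]
        linarith
  eq_of_dist_eq_zero := by
    intro x y h
    have hx := x.height_nonneg
    have hy := y.height_nonneg
    by_cases hl : x.leg = y.leg
    · rw [dist_eq_abs hl] at h
      exact Hedgehog.ext hl (sub_eq_zero.1 (abs_eq_zero.1 h))
    · rw [dist_eq_add hl] at h
      exact absurd ((x.leg_eq_zero (by linarith)).trans (y.leg_eq_zero (by linarith)).symm) hl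

/-- The point of height `max c 0` on the leg `i`. -/
noncomputable def onLeg (i : ℕ) (c : ℝ) : Hedgehog where
  leg := if c ≤ 0 then 0 else i
  height := max c 0
  height_nonneg := le_max_right _ _
  leg_eq_zero h := if_pos (max_eq_right_iff.1 h)

theorem onLeg_leg_height (x : Hedgehog) : onLeg x.leg x.height = x := by
  refine Hedgehog.ext ?_ (max_eq_left x.height_nonneg)
  by_cases h : x.height ≤ 0
  · exact (if_pos h).trans (x.leg_eq_zero (le_antisymm h x.height_nonneg)).symm
  · exact if_neg h

theorem height_onLeg (i : ℕ) {c : ℝ} (hc : 0 ≤ c) : (onLeg i c).height = c := max_eq_left hc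

/-- Height `0` is normalised to the leg `0`, so the two legs may disagree when `c` or `d` vanishes.
Then the sum and the difference of the heights agree in absolute value, and the two general bounds
on the distance meet. -/
theorem dist_onLeg_same (i : ℕ) {c d : ℝ} (hc : 0 ≤ c) (hd : 0 ≤ d) :
    dist (onLeg i c) (onLeg i d) = |c - d| := by
  rcases hc.eq_or_lt with rfl | hc' <;> rcases hd.eq_or_lt with rfl | hd'
  · simp
  · refine le_antisymm ((dist_le_add _ _).trans ?_) ?_
    · rw [height_onLeg _ le_rfl, height_onLeg _ hd, zero_add, zero_sub, abs_neg, abs_of_nonneg hd]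
    · simpa only [height_onLeg _ le_rfl, height_onLeg _ hd] using abs_sub_le_dist (onLeg i 0) (onLeg i d)
  · refine le_antisymm ((dist_le_add _ _).trans ?_) ?_
    · rw [height_onLeg _ le_rfl, height_onLeg _ hc, add_zero, sub_zero, abs_of_nonneg hc]
    · simpa only [height_onLeg _ le_rfl, height_onLeg _ hc] using abs_sub_le_dist (onLeg i c) (onLeg i 0)
  · rw [dist_eq_abs (by simp [onLeg, hc'.not_ge, hd'.not_ge]), height_onLeg _ hc, height_onLeg _ hd]

theorem onLeg_zero (i j : ℕ) : onLeg i 0 = onLeg j 0 := by simp [onLeg]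

theorem dist_onLeg_of_ne {i j : ℕ} (hij : i ≠ j) {c d : ℝ} (hc : 0 ≤ c) (hd : 0 ≤ d) :
    dist (onLeg i c) (onLeg j d) = c + d := by
  rcases hc.eq_or_lt with rfl | hc'
  · rw [onLeg_zero i j, dist_onLeg_same j le_rfl hd, zero_sub, abs_neg, abs_of_nonneg hd, zero_add]
  rcases hd.eq_or_lt with rfl | hd'
  · rw [onLeg_zero j i, dist_onLeg_same i hc le_rfl, sub_zero, abs_of_nonneg hc, add_zero]
  · rw [dist_eq_add (by simpa [onLeg, hc'.not_ge, hd'.not_ge] using hij), height_onLeg _ hc,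
      height_onLeg _ hd]

/-- The coordinate that is the height on the leg `i` and minus the height elsewhere. -/
noncomputable def signedHeight (i : ℕ) (x : Hedgehog) : ℝ :=
  if x.leg = i then x.height else -x.height

theorem continuous_signedHeight (i : ℕ) : Continuous (signedHeight i) := by
  refine (LipschitzWith.of_dist_le_mul (K := 1) fun x y => ?_).continuous
  have h1 := abs_le.1 (abs_sub_le_dist x y)
  rw [NNReal.coe_one, one_mul, Real.dist_eq, signedHeight, signedHeight, abs_le]
  have hx := x.height_nonneg
  have hy := y.height_nonneg
  split_ifs with h2 h3 h3
  · exact h1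
  · rw [dist_eq_add fun h => h3 (h ▸ h2)]
    constructor <;> linarith
  · rw [dist_eq_add fun h => h2 (h.trans h3)]
    constructor <;> linarith
  · constructor <;> linarith

/-- Nonnegative values of the signed height have a single preimage, because points off the leg have
negative values. Combined with the intermediate value theorem, this forces paths through the points
of a geodesic. -/
theorem eq_onLeg_of_signedHeight {i : ℕ} {x : Hedgehog} {c : ℝ} (hc : 0 ≤ c)
    (h : signedHeight i x = c) : x = onLeg i c := by
  unfold signedHeight at h
  split_ifs at h with hi
  · rw [← h, ← hi, onLeg_leg_height]
  · have hx := x.height_nonneg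
    have h0 : c = 0 := by linarith
    have hx0 : x.height = 0 := by linarith
    rw [h0, onLeg_zero i x.leg]
    nth_rw 1 [← onLeg_leg_height x, hx0]

theorem onLeg_mem_range {x y : Hedgehog} (p : Path x y) {i : ℕ} {c : ℝ} (hc : 0 ≤ c)
    (h : c ∈ Set.uIcc (signedHeight i x) (signedHeight i y)) : onLeg i c ∈ Set.range p := by
  have hcont : Continuous fun s => signedHeight i (p s) :=
    (continuous_signedHeight i).comp p.continuous
  have hx : signedHeight i (p 0) = signedHeight i x := by rw [p.source]
  have hy : signedHeight i (p 1) = signedHeight i y := by rw [p.target]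
  obtain ⟨s, hs⟩ : c ∈ Set.range fun s => signedHeight i (p s) := by
    rcases Set.mem_uIcc.1 h with ⟨h1, h2⟩ | ⟨h1, h2⟩
    · exact mem_range_of_exists_le_of_exists_ge hcont ⟨0, hx.trans_le h1⟩ ⟨1, h2.trans hy.ge⟩
    · exact mem_range_of_exists_le_of_exists_ge hcont ⟨1, hy.trans_le h1⟩ ⟨0, h2.trans hx.ge⟩
  exact ⟨s, eq_onLeg_of_signedHeight hc hs⟩

theorem isRTree : IsRTree Hedgehog := by
  refine isRTree_of_geodesic fun x y hxy => ?_
  have hx := x.height_nonneg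
  have hy := y.height_nonneg
  by_cases h : x.leg = y.leg
  · have hsx : signedHeight x.leg x = x.height := if_pos rfl
    have hsy : signedHeight x.leg y = y.height := if_pos h.symm
    rw [dist_eq_abs h]
    rcases le_total x.height y.height with hle | hle
    · rw [abs_sub_comm, abs_of_nonneg (sub_nonneg.2 hle)]
      refine ⟨fun s => onLeg x.leg (x.height + s), ?_, ?_, fun s hs t ht => ?_, fun p s hs => ?_⟩
      · simp [onLeg_leg_height]
      · simp [h, onLeg_leg_height]
      · rw [dist_onLeg_same _ (by linarith [hs.1]) (by linarith [ht.1]), add_sub_add_left_eq_sub]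
      · refine onLeg_mem_range p (by linarith [hs.1]) (Set.mem_uIcc.2 (Or.inl ?_))
        rw [hsx, hsy]
        constructor <;> linarith [hs.1, hs.2]
    · rw [abs_of_nonneg (sub_nonneg.2 hle)]
      refine ⟨fun s => onLeg x.leg (x.height - s), ?_, ?_, fun s hs t ht => ?_, fun p s hs => ?_⟩
      · simp [onLeg_leg_height]
      · simp [h, onLeg_leg_height]
      · rw [dist_onLeg_same _ (by linarith [hs.2]) (by linarith [ht.2]), sub_sub_sub_cancel_left,
          abs_sub_comm]
      · refine onLeg_mem_range p (by linarith [hs.2]) (Set.mem_uIcc.2 (Or.inr ?_))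
        rw [hsx, hsy]
        constructor <;> linarith [hs.1, hs.2]
  · rw [dist_eq_add h]
    -- The geodesic descends the leg of `x` to the origin and then climbs the leg of `y`.
    refine ⟨fun s => if s ≤ x.height then onLeg x.leg (x.height - s)
      else onLeg y.leg (s - x.height), ?_, ?_, fun s hs t ht => ?_, fun p s hs => ?_⟩
    · simp [onLeg_leg_height, hx]
    · by_cases hy0 : y.height ≤ 0
      · have hy0' : y.height = 0 := le_antisymm hy0 hy
        simp only [hy0', add_zero, le_refl, if_true, sub_self]
        rw [onLeg_zero _ y.leg]
        nth_rw 2 [← onLeg_leg_height y]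
        rw [hy0']
      · simp [hy0, onLeg_leg_height]
    · dsimp only
      split_ifs with h1 h2 h2
      · rw [dist_onLeg_same _ (by linarith) (by linarith), sub_sub_sub_cancel_left, abs_sub_comm]
      · rw [dist_onLeg_of_ne h (by linarith) (by linarith), abs_of_nonpos (by linarith)]
        ring
      · rw [dist_onLeg_of_ne (Ne.symm h) (by linarith) (by linarith), abs_of_nonneg (by linarith)]
        ring
      · rw [dist_onLeg_same _ (by linarith) (by linarith), sub_sub_sub_cancel_right]
    · have hsx : signedHeight x.leg x = x.height := if_pos rfl
      have hsy : signedHeight x.leg y = -y.height := if_neg (Ne.symm h)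
      have hsx' : signedHeight y.leg x = -x.height := if_neg h
      have hsy' : signedHeight y.leg y = y.height := if_pos rfl
      dsimp only
      split_ifs with h1
      · refine onLeg_mem_range p (by linarith) (Set.mem_uIcc.2 (Or.inr ?_))
        rw [hsx, hsy]
        constructor <;> linarith [hs.1, hs.2]
      · refine onLeg_mem_range p (by linarith) (Set.mem_uIcc.2 (Or.inl ?_))
        rw [hsx', hsy']
        constructor <;> linarith [hs.1, hs.2]

end Hedgehog

/-! ### Nets in TSP-efficient spaces -/

/-- A walk through a finite `s`-separated set `S` has length at least `(#S - 1) * s`, and even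
more if it ends away from `S`. -/
theorem exists_card_mul_add_dist_le_sum_dist {X : Type*} [MetricSpace X] {s : ℝ} (p : ℕ → X)
    (k : ℕ) : ∀ S : Finset X, S.Nonempty → (∀ z ∈ S, ∀ w ∈ S, z ≠ w → s ≤ dist z w) →
      (∀ z ∈ S, ∃ i ≤ k, p i = z) →
      ∃ z ∈ S, ((S.card : ℝ) - 1) * s + dist z (p k) ≤
        ∑ i ∈ Finset.range k, dist (p i) (p (i + 1)) := by
  classical
  induction k with
  | zero =>
    intro S hS _ hv
    obtain ⟨z, hz⟩ := hS
    have hall : ∀ w ∈ S, w = p 0 := by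
      intro w hw
      obtain ⟨i, hi, rfl⟩ := hv w hw
      rw [Nat.le_zero.1 hi]
    have hone : S = {p 0} := Finset.eq_singleton_iff_unique_mem.2 ⟨hall z hz ▸ hz, hall⟩
    refine ⟨z, hz, ?_⟩
    simp [hone, hall z hz]
  | succ k ih =>
    intro S hS hsep hv
    rw [Finset.sum_range_succ]
    have hprev : ∀ z ∈ S, z ≠ p (k + 1) → ∃ i ≤ k, p i = z := by
      intro z hz hne
      obtain ⟨i, hi, rfl⟩ := hv z hz
      rcases Nat.le_succ_iff.1 hi with h | rfl
      · exact ⟨i, h, rfl⟩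
      · exact absurd rfl hne
    -- If the walk ends in `S`, the end point is removed before applying induction. The extra term
    -- `dist z (p k)` and the last step together cover the distance from `z` to the new point, which
    -- is at least `s`. Otherwise the last step only updates the extra term.
    by_cases hk : p (k + 1) ∈ S
    · refine ⟨_, hk, ?_⟩
      rw [dist_self, add_zero]
      rcases (S.erase (p (k + 1))).eq_empty_or_nonempty with he | hne
      · have hcard := Finset.card_erase_add_one hk
        rw [he, Finset.card_empty, zero_add] at hcard
        rw [← hcard, Nat.cast_one, sub_self, zero_mul]
        positivity
      · obtain ⟨z, hz, hle⟩ := ih (S.erase (p (k + 1))) hne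
          (fun z hz w hw => hsep z (Finset.mem_of_mem_erase hz) w (Finset.mem_of_mem_erase hw))
          (fun z hz => hprev z (Finset.mem_of_mem_erase hz) (Finset.ne_of_mem_erase hz))
        have h1 := hsep z (Finset.mem_of_mem_erase hz) _ hk (Finset.ne_of_mem_erase hz)
        have h2 := dist_triangle z (p k) (p (k + 1))
        have hcard : (((S.erase (p (k + 1))).card : ℝ) + 1) = S.card := by
          exact_mod_cast Finset.card_erase_add_one hk
        rw [← hcard]
        linarith
    · obtain ⟨z, hz, hle⟩ := ih S hS hsep fun z hz => hprev z hz fun h => hk (h ▸ hz)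
      exact ⟨z, hz, by linarith [dist_triangle z (p k) (p (k + 1))]⟩

namespace IsTSPEfficient

theorem mono {K L : ℝ} {X : Type*} [MetricSpace X] (h : IsTSPEfficient K X) (hKL : K ≤ L) :
    IsTSPEfficient L X := fun a b =>
  (h a b).trans (mul_le_mul_of_nonneg_right hKL Metric.diam_nonneg)

/-- Separated subsets of a TSP-efficient space have at most linear growth. -/
theorem card_sub_one_mul_le {K : ℝ} {X : Type*} [MetricSpace X] (h : IsTSPEfficient K X)
    (hK : 0 ≤ K) {s D : ℝ} {S : Finset X} (hS : S.Nonempty)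
    (hsep : ∀ z ∈ S, ∀ w ∈ S, z ≠ w → s ≤ dist z w) (hD : ∀ z ∈ S, ∀ w ∈ S, dist z w ≤ D) :
    ((S.card : ℝ) - 1) * s ≤ K * D := by
  obtain ⟨x, hx⟩ := hS
  -- The test pair switches off exactly the lamps of `S`, starting and ending at a point of `S`, so
  -- its shortcut length is the diameter of `S`.
  have hdiff : Lamplighter.diffLamps ⟨S, x⟩ ⟨∅, x⟩ = (S : Set X) := by
    simp [Lamplighter.diffLamps]
  have hdiam : Lamplighter.tscp (⟨S, x⟩ : Lamplighter X) ⟨∅, x⟩ ≤ D := by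
    refine Metric.diam_le_of_forall_dist_le (dist_nonneg.trans (hD x hx x hx)) ?_
    have hset : ({x, x} ∪ Lamplighter.diffLamps ⟨S, x⟩ ⟨∅, x⟩ : Set X) = S := by
      rw [hdiff, Set.pair_eq_singleton, Set.singleton_union]
      exact Set.insert_eq_of_mem hx
    rw [hset]
    exact hD
  refine le_trans ?_ ((h ⟨S, x⟩ ⟨∅, x⟩).trans (mul_le_mul_of_nonneg_left hdiam hK))
  refine le_csInf (Lamplighter.walkLengths_nonempty _ _) ?_
  rintro _ ⟨k, p, -, -, hv, rfl⟩
  rw [hdiff] at hv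
  obtain ⟨z, -, hz⟩ := exists_card_mul_add_dist_le_sum_dist p k S ⟨x, hx⟩ hsep hv
  linarith [dist_nonneg (x := z) (y := p k)]

end IsTSPEfficient

/-- Greedy colouring: finitely many points, each conflicting with fewer than `n` others, can be
coloured with `n` colours without conflicts. -/
theorem exists_coloring_of_card_lt {α : Type*} {r : α → α → Prop} (hr : ∀ a b, r a b → r b a)
    {n : ℕ} (S : Finset α)
    (hn : ∀ a ∈ S, ∀ N ⊆ S, a ∉ N → (∀ b ∈ N, r a b) → N.card < n) :
    ∃ c : α → ℕ, (∀ a ∈ S, c a < n) ∧ ∀ a ∈ S, ∀ b ∈ S, a ≠ b → r a b → c a ≠ c b := by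
  classical
  induction S using Finset.induction_on with
  | empty => exact ⟨fun _ => 0, by simp, by simp⟩
  | insert a S ha ih =>
    obtain ⟨c, hc, hcr⟩ := ih fun b hb N hN => hn b (Finset.mem_insert_of_mem hb) N
      (hN.trans (Finset.subset_insert _ _))
    have hlt : ((S.filter (r a)).image c).card < (Finset.range n).card := by
      rw [Finset.card_range]
      refine Finset.card_image_le.trans_lt (hn a (Finset.mem_insert_self _ _) _
        ((Finset.filter_subset _ _).trans (Finset.subset_insert _ _)) ?_ ?_)
      · exact fun h => ha (Finset.mem_filter.1 h).1
      · exact fun b hb => (Finset.mem_filter.1 hb).2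
    obtain ⟨m, hm, hmc⟩ := Finset.exists_mem_notMem_of_card_lt_card hlt
    have hne : ∀ b ∈ S, b ≠ a := fun b hb h => ha (h ▸ hb)
    have hfree : ∀ b ∈ S, r a b → m ≠ c b := fun b hb hab h =>
      hmc (Finset.mem_image.2 ⟨b, Finset.mem_filter.2 ⟨hb, hab⟩, h.symm⟩)
    refine ⟨Function.update c a m, ?_, ?_⟩
    · intro b hb
      rcases Finset.mem_insert.1 hb with rfl | hb
      · simpa using hm
      · simpa [hne b hb] using hc b hb
    · intro b hb d hd hbd hrbd
      rcases Finset.mem_insert.1 hb with rfl | hbS <;>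
        rcases Finset.mem_insert.1 hd with rfl | hdS
      · exact absurd rfl hbd
      · simpa [hne d hdS] using hfree d hdS hrbd
      · simpa [hne b hbS] using (hfree b hbS (hr _ _ hrbd)).symm
      · simpa [hne b hbS, hne d hdS] using hcr b hbS d hdS hbd hrbd

/-- A finite metric space has a maximal `t`-separated subset. -/
theorem exists_separated_net (X : Type*) [MetricSpace X] [Finite X] {t : ℝ} (ht : 0 < t) :
    ∃ S : Finset X, (∀ z ∈ S, ∀ w ∈ S, z ≠ w → t ≤ dist z w) ∧ ∀ x, ∃ z ∈ S, dist x z < t := by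
  classical
  obtain ⟨S, hS⟩ := (Set.toFinite {S : Finset X | ∀ z ∈ S, ∀ w ∈ S, z ≠ w → t ≤ dist z w})
    |>.exists_maximal ⟨∅, by simp⟩
  refine ⟨S, hS.prop, fun x => ?_⟩
  by_contra! hx
  have hmem : x ∈ S := by
    refine hS.le_of_ge (y := insert x S) ?_ (Finset.subset_insert x S)
      (Finset.mem_insert_self x S)
    intro z hz w hw hzw
    rcases Finset.mem_insert.1 hz with rfl | hzS <;>
      rcases Finset.mem_insert.1 hw with rfl | hwS
    · exact absurd rfl hzw
    · exact hx w hwS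
    · exact dist_comm w z ▸ hx z hzS
    · exact hS.prop z hzS w hwS hzw
  exact absurd (hx x hmem) (by simpa using ht)

/-- A `t`-dense subset of a finite `K`-TSP-efficient space that splits into `⌊8 K⌋₊ + 1` colours,
points of the same colour being at distance at least `4 t`. -/
theorem IsTSPEfficient.exists_colored_net {K : ℝ} {X : Type*} [MetricSpace X] [Finite X]
    (h : IsTSPEfficient K X) (hK : 0 ≤ K) {t : ℝ} (ht : 0 < t) :
    ∃ (S : Finset X) (c : X → ℕ), (∀ z ∈ S, c z < ⌊8 * K⌋₊ + 1) ∧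
      (∀ z ∈ S, ∀ w ∈ S, z ≠ w → c z = c w → 4 * t ≤ dist z w) ∧
      ∀ x, ∃ z ∈ S, dist x z < t := by
  classical
  obtain ⟨S, hsep, hnet⟩ := exists_separated_net X ht
  obtain ⟨c, hc, hcr⟩ := exists_coloring_of_card_lt (r := fun z w : X => dist z w < 4 * t)
    (n := ⌊8 * K⌋₊ + 1) (fun z w hzw => by rwa [dist_comm]) S fun a ha N hN haN hr => by
      have hsub : insert a N ⊆ S := Finset.insert_subset ha hN
      have hnear : ∀ z ∈ insert a N, dist a z ≤ 4 * t := by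
        intro z hz
        rcases Finset.mem_insert.1 hz with rfl | hz
        · rw [dist_self]
          positivity
        · exact (hr z hz).le
      -- Conflicting points lie within `4 t` of `a`, hence within `8 t` of one another. Including
      -- `a` absorbs the `- 1` of the growth bound and gives `N.card ≤ 8 * K`.
      have hcard := h.card_sub_one_mul_le hK (s := t) (D := 8 * t) (Finset.insert_nonempty a N)
        (fun z hz w hw => hsep z (hsub hz) w (hsub hw)) fun z hz w hw => by
          linarith [hnear z hz, hnear w hw, dist_triangle_left z w a]
      rw [Finset.card_insert_of_notMem haN, Nat.cast_add, Nat.cast_one, add_sub_cancel_right,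
        ← mul_assoc, mul_comm K] at hcard
      exact Nat.lt_succ_of_le (Nat.le_floor (le_of_mul_le_mul_right hcard ht))
  refine ⟨S, c, hc, fun z hz w hw hzw hcol => ?_, hnet⟩
  by_contra! hlt
  exact hcr z hz w hw hzw hlt hcol

/-! ### The embedding -/

namespace Lamplighter

variable {X : Type*}

theorem rho_nonneg (a b : Lamplighter X) : 0 ≤ rho a b := by
  unfold rho
  split_ifs <;> norm_num

theorem rho_le_one (a b : Lamplighter X) : rho a b ≤ 1 := by
  unfold rho
  split_ifs <;> norm_num

variable [MetricSpace X]

theorem tsp_nonneg (a b : Lamplighter X) : 0 ≤ tsp a b :=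
  dist_nonneg.trans (dist_le_tsp a b)

theorem dist_pos_le_dist (a b : Lamplighter X) : dist a.pos b.pos ≤ dist a b := by
  rw [dist_def]
  linarith [dist_le_tsp a b, rho_nonneg a b]

theorem one_le_dist {a b : Lamplighter X} (h : a.lamps ≠ b.lamps) : 1 ≤ dist a b := by
  rw [dist_def, rho, if_neg h]
  linarith [tsp_nonneg a b]

theorem dist_le_tsp_of_mem_diffLamps {a b : Lamplighter X} {z : X} (hz : z ∈ diffLamps a b) :
    dist a.pos z ≤ tsp a b := by
  refine le_csInf (walkLengths_nonempty a b) ?_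
  rintro _ ⟨k, p, h0, -, hv, rfl⟩
  obtain ⟨i, hi, rfl⟩ := hv z hz
  rw [← h0]
  exact (dist_le_range_sum_dist p i).trans (Finset.sum_le_sum_of_subset_of_nonneg
    (Finset.range_subset_range.2 hi) fun _ _ _ => dist_nonneg)

open Classical in
/-- The lamps recorded at scale `r` around `z`: those outside the ball of radius `r`, and all of
them when `r ≤ 1`. -/
noncomputable def farLamps (r : ℝ) (z : X) (a : Lamplighter X) : Finset X :=
  if r ≤ 1 then a.lamps else a.lamps.filter fun w => r ≤ dist w z

/-- Some lamp at distance at least `r` from `z` must be switched, and the walk has to reach it. For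
`r ≤ 1` the lamp may be near, but then `rho` alone contributes `1`. -/
theorem sub_dist_le_dist_of_farLamps_ne {r : ℝ} {z : X} {a b : Lamplighter X}
    (h : farLamps r z a ≠ farLamps r z b) : r - dist a.pos z ≤ dist a b := by
  unfold farLamps at h
  split_ifs at h with hr
  · linarith [one_le_dist h, dist_nonneg (x := a.pos) (y := z)]
  · obtain ⟨w, hw⟩ : ∃ w, w ∈ diffLamps a b ∧ r ≤ dist w z := by
      by_contra! hall
      refine h (Finset.ext fun w => ?_)
      simp only [Finset.mem_filter]
      refine and_congr_left fun hw => ?_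
      by_contra hne
      refine absurd hw (hall w ?_).not_ge
      simp only [diffLamps, Set.mem_symmDiff, Finset.mem_coe]
      tauto
    have h1 := dist_le_tsp_of_mem_diffLamps hw.1
    rw [dist_def]
    linarith [rho_nonneg a b, hw.2, dist_triangle_left w z a.pos]

/-- All differing lamps and both positions lie in a ball of radius `r`, so the shortcut length is at
most `2 r` and efficiency applies. If any lamp differs then `r > 1`, by the threshold in `farLamps`,
so `rho` costs at most `r`. -/
theorem dist_le_of_farLamps_eq {K r : ℝ} (hX : IsTSPEfficient K X) (hK : 0 ≤ K) (hr : 0 < r)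
    {z : X} {a b : Lamplighter X} (h : farLamps r z a = farLamps r z b)
    (ha : dist a.pos z < r) (hb : dist b.pos z < r) : dist a b ≤ (2 * K + 1) * r := by
  have hdiff : ∀ w ∈ diffLamps a b, dist w z ≤ r ∧ ¬ r ≤ 1 := by
    intro w hw
    unfold farLamps at h
    simp only [diffLamps, Set.mem_symmDiff, Finset.mem_coe] at hw
    split_ifs at h with hr1
    · rw [h] at hw
      tauto
    · refine ⟨?_, hr1⟩
      by_contra! hlt
      have := Finset.ext_iff.1 h w
      simp only [Finset.mem_filter, hlt.le, and_true] at this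
      tauto
  have hball : ∀ w ∈ ({a.pos, b.pos} ∪ diffLamps a b : Set X), dist w z ≤ r := by
    rintro w ((rfl | rfl) | hw)
    · exact ha.le
    · exact hb.le
    · exact (hdiff w hw).1
  have htscp : tscp a b ≤ 2 * r := by
    refine Metric.diam_le_of_forall_dist_le (by positivity) fun w hw v hv => ?_
    linarith [hball w hw, hball v hv, dist_triangle_right w v z]
  have hrho : rho a b ≤ r := by
    by_cases hl : a.lamps = b.lamps
    · rw [rho, if_pos hl]
      exact hr.le
    · obtain ⟨w, hw⟩ : (diffLamps a b).Nonempty := by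
        rw [diffLamps, Set.nonempty_iff_ne_empty]
        simpa [symmDiff_eq_bot] using hl
      linarith [rho_le_one a b, (hdiff w hw).2]
  rw [dist_def]
  nlinarith [hX a b, mul_le_mul_of_nonneg_left htscp hK]

open Classical in
/-- The map to the hedgehog given by a set `P` of centres: a point of the lamplighter space whose
position is within `r` of a centre `z` is sent to the leg coded by `z` and the lamps far from `z`,
the higher the closer its position is to `z`; the other points are sent to the origin. -/
noncomputable def toHedgehog (e : X × Finset X → ℕ) (r : ℝ) (P : Set X) (a : Lamplighter X) :
    Hedgehog :=
  if h : ∃ z ∈ P, dist a.pos z < r then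
    Hedgehog.onLeg (e (h.choose, farLamps (2 * r) h.choose a)) (r - dist a.pos h.choose)
  else Hedgehog.onLeg 0 0

/-- The balls of radius `r` around the centres are disjoint, so the chosen centre can only be `z`.
-/
theorem toHedgehog_of_dist_lt (e : X × Finset X → ℕ) {r : ℝ} {P : Set X}
    (hP : ∀ z ∈ P, ∀ w ∈ P, z ≠ w → 2 * r ≤ dist z w) {a : Lamplighter X} {z : X}
    (hz : z ∈ P) (ha : dist a.pos z < r) :
    toHedgehog e r P a = Hedgehog.onLeg (e (z, farLamps (2 * r) z a)) (r - dist a.pos z) := by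
  have h : ∃ z ∈ P, dist a.pos z < r := ⟨z, hz, ha⟩
  have heq : h.choose = z := by
    by_contra hne
    linarith [hP _ h.choose_spec.1 z hz hne, h.choose_spec.2,
      dist_triangle_left h.choose z a.pos]
  rw [toHedgehog, dif_pos h, heq]

theorem toHedgehog_of_le_dist (e : X × Finset X → ℕ) {r : ℝ} {P : Set X} {a : Lamplighter X}
    (ha : ∀ z ∈ P, r ≤ dist a.pos z) : toHedgehog e r P a = Hedgehog.onLeg 0 0 :=
  dif_neg fun ⟨z, hz, hlt⟩ => hlt.not_ge (ha z hz)

/-- On different legs the distance is `2 r` minus the two distances to the centres. For different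
centres this is paid by their separation; for one centre with different lamp records, by the
recording radius `2 r`. No injectivity of `e` is needed, as merging legs only shortens distances. -/
theorem dist_toHedgehog_le {e : X × Finset X → ℕ} {r : ℝ} {P : Set X}
    (hP : ∀ z ∈ P, ∀ w ∈ P, z ≠ w → 2 * r ≤ dist z w) (a b : Lamplighter X) :
    dist (toHedgehog e r P a) (toHedgehog e r P b) ≤ dist a b := by
  have hpos := dist_pos_le_dist a b
  have hcentre : ∀ (c : Lamplighter X) (z : X), dist c.pos z < r →
      ∀ i, dist (Hedgehog.onLeg i (r - dist c.pos z)) (Hedgehog.onLeg 0 0) = r - dist c.pos z := by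
    intro c z hc i
    rw [Hedgehog.onLeg_zero 0 i, Hedgehog.dist_onLeg_same i (by linarith) le_rfl, sub_zero,
      abs_of_pos (by linarith)]
  by_cases ha : ∃ z ∈ P, dist a.pos z < r <;> by_cases hb : ∃ w ∈ P, dist b.pos w < r
  · obtain ⟨z, hz, haz⟩ := ha
    obtain ⟨w, hw, hbw⟩ := hb
    rw [toHedgehog_of_dist_lt e hP hz haz, toHedgehog_of_dist_lt e hP hw hbw]
    have hsum := Hedgehog.dist_le_add
      (Hedgehog.onLeg (e (z, farLamps (2 * r) z a)) (r - dist a.pos z))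
      (Hedgehog.onLeg (e (w, farLamps (2 * r) w b)) (r - dist b.pos w))
    rw [Hedgehog.height_onLeg _ (by linarith), Hedgehog.height_onLeg _ (by linarith)] at hsum
    by_cases hzw : z = w
    · subst hzw
      by_cases hl : farLamps (2 * r) z a = farLamps (2 * r) z b
      · rw [hl, Hedgehog.dist_onLeg_same _ (by linarith) (by linarith), sub_sub_sub_cancel_left]
        rw [abs_sub_comm]
        exact (abs_dist_sub_le _ _ _).trans hpos
      · linarith [sub_dist_le_dist_of_farLamps_ne hl, dist_nonneg (x := b.pos) (y := z)]
    · linarith [hP z hz w hw hzw, dist_triangle4 z a.pos b.pos w, dist_comm z a.pos]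
  · obtain ⟨z, hz, haz⟩ := ha
    push Not at hb
    rw [toHedgehog_of_dist_lt e hP hz haz, toHedgehog_of_le_dist e hb, hcentre a z haz]
    linarith [hb z hz, dist_triangle_left b.pos z a.pos]
  · obtain ⟨w, hw, hbw⟩ := hb
    push Not at ha
    rw [toHedgehog_of_dist_lt e hP hw hbw, toHedgehog_of_le_dist e ha, dist_comm, hcentre b w hbw]
    linarith [ha w hw, dist_triangle a.pos b.pos w]
  · push Not at ha hb
    rw [toHedgehog_of_le_dist e ha, toHedgehog_of_le_dist e hb, dist_self]
    exact dist_nonneg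

/-- Equal codes would bound the distance by `dist_le_of_farLamps_eq` at radius `2 r`. So the image
of `b` lies on another leg or at the origin, and the distance is at least the height of the image of
`a`. -/
theorem sub_dist_le_dist_toHedgehog {K r : ℝ} (hX : IsTSPEfficient K X) (hK : 0 ≤ K)
    (hr : 0 < r) {e : X × Finset X → ℕ} (he : Function.Injective e) {P : Set X}
    (hP : ∀ z ∈ P, ∀ w ∈ P, z ≠ w → 2 * r ≤ dist z w) {a b : Lamplighter X} {z : X}
    (hz : z ∈ P) (ha : dist a.pos z < r) (hab : (2 * K + 1) * (2 * r) < dist a b) :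
    r - dist a.pos z ≤ dist (toHedgehog e r P a) (toHedgehog e r P b) := by
  rw [toHedgehog_of_dist_lt e hP hz ha]
  by_cases hb : ∃ w ∈ P, dist b.pos w < r
  · obtain ⟨w, hw, hbw⟩ := hb
    rw [toHedgehog_of_dist_lt e hP hw hbw, Hedgehog.dist_onLeg_of_ne ?_ (by linarith) (by linarith)]
    · linarith
    · intro heq
      obtain ⟨rfl, hl⟩ := Prod.mk.inj (he heq)
      exact hab.not_ge (dist_le_of_farLamps_eq hX hK (by linarith) hl (by linarith)
        (by linarith))
  · push Not at hb
    rw [toHedgehog_of_le_dist e hb, Hedgehog.onLeg_zero 0,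
      Hedgehog.dist_onLeg_same _ (by linarith) le_rfl, sub_zero]
    exact le_abs_self _

end Lamplighter

/-- For every `K` there are `n` and `C`, depending only on `K`, such that the lamplighter space
(with the metric `tsp + rho`) over any finite `K`-TSP-efficient metric space admits a weak
`C`-biLipschitz embedding into a product of `n` real trees; the product type
`∀ i, T i` over `Fin n` carries the maximum metric. -/
theorem theorem3p6 (K : ℝ) :
    ∃ (n : ℕ) (C : ℝ), ∀ (X : Type*) [MetricSpace X] [Finite X], IsTSPEfficient K X →
      ∃ (T : Fin n → Type) (_ : ∀ i, MetricSpace (T i)), (∀ i, IsRTree (T i)) ∧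
        ∃ φ : ℝ → Lamplighter X → (∀ i, T i), IsWeakBiLipschitzEmbedding C φ := by
  have hL : 0 ≤ max K 0 := le_max_right _ _
  -- There is one tree per colour. With `r = 2 * t` the threshold `(2 * K + 1) * (2 * r)` becomes
  -- `(2 * K + 1) * 4 * t`, and the final `+ 1` makes the inequality strict.
  refine ⟨⌊8 * max K 0⌋₊ + 1, (2 * max K 0 + 1) * 4 + 1, fun X _ _ hX => ?_⟩
  replace hX := hX.mono (le_max_left K 0)
  obtain ⟨e, he⟩ := exists_injective_nat (X × Finset X)
  choose S c hc hsep hnet using fun t : Set.Ioi (0 : ℝ) => hX.exists_colored_net hL t.2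
  refine ⟨fun _ => Hedgehog, fun _ => inferInstance, fun _ => Hedgehog.isRTree,
    fun t a i => if ht : 0 < t then
      Lamplighter.toHedgehog e (2 * t) {z | z ∈ S ⟨t, ht⟩ ∧ c ⟨t, ht⟩ z = i} a
      else Hedgehog.onLeg 0 0, fun t ht => ⟨1, one_pos, fun a b => ?_⟩⟩
  simp only [dif_pos ht, one_mul, mul_one]
  have hP : ∀ i : Fin (⌊8 * max K 0⌋₊ + 1), ∀ z ∈ {z | z ∈ S ⟨t, ht⟩ ∧ c ⟨t, ht⟩ z = i},
      ∀ w ∈ {z | z ∈ S ⟨t, ht⟩ ∧ c ⟨t, ht⟩ z = i}, z ≠ w → 2 * (2 * t) ≤ dist z w := by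
    intro i z hz w hw hzw
    have h4 : 4 * t ≤ dist z w := hsep ⟨t, ht⟩ z hz.1 w hw.1 hzw (hz.2.trans hw.2.symm)
    linarith
  refine ⟨(dist_pi_le_iff dist_nonneg).2 fun i => Lamplighter.dist_toHedgehog_le (hP i) a b,
    fun hab => ?_⟩
  -- The net is `t`-dense while the balls have radius `2 * t`, so in the factor given by the colour
  -- of `z` the image of `a` has height above `t`.
  obtain ⟨z, hz, haz⟩ := hnet ⟨t, ht⟩ a.pos
  replace haz : dist a.pos z < t := haz
  let i : Fin (⌊8 * max K 0⌋₊ + 1) := ⟨c ⟨t, ht⟩ z, hc ⟨t, ht⟩ z hz⟩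
  have hfar := Lamplighter.sub_dist_le_dist_toHedgehog hX hL (r := 2 * t) (by linarith) he
    (hP i) (a := a) (b := b) ⟨hz, rfl⟩ (by linarith) (by linarith)
  refine le_trans (by linarith) (hfar.trans ?_)
  exact dist_le_pi_dist (fun j : Fin (⌊8 * max K 0⌋₊ + 1) => Lamplighter.toHedgehog e (2 * t)
    {z | z ∈ S ⟨t, ht⟩ ∧ c ⟨t, ht⟩ z = j} a) (fun j => Lamplighter.toHedgehog e (2 * t)
    {z | z ∈ S ⟨t, ht⟩ ∧ c ⟨t, ht⟩ z = j} b) i
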